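/- All rings are commutative with nonzero identity and all ring homomorphisms are unital. An injective ring homomorphism $f\colon R\hookrightarrow T$ that is not an isomorphism is called minimal if there is no ring strictly between $R$ and $T$, i.e. for every factorization $f=g\circ h$ with $h\colon R\to S$ and $g\colon S\to T$ ring homomorphisms and $g$ injective, one of $g,h$ is an isomorphism. For a prime ideal $P$ of $R$ write $T_P:=T_{R\setminus P}$. The crucial maximal ideal of a minimal ring homomorphism $R\hookrightarrow T$ is the (unique) maximal ideal $J$ of $R$ for which $R_J\hookrightarrow T_J$ is not an isomorphism. For a ring extension $A\subseteq B$ let $(A:B):=\{b\in B : bB\subseteq A\}$, which is an ideal of both $A$ and $B$. Theorem. Let $R\hookrightarrow T$ be a minimal ring homomorphism with crucial maximal ideal $J$. Then $R\hookrightarrow T$ is a flat epimorphism (that is, $T$ is a flat $R$-module and $R\hookrightarrow T$ is an epimorphism of commutative rings) if and only if $R_J/(R_J:T_J)$ is a one-dimensional valuation ring (a valuation domain of Krull dimension one) and $T_J/(R_J:T_J)$ is its quotient field, via the homomorphism $R_J/(R_J:T_J)\to T_J/(R_J:T_J)$ induced by $R_J\hookrightarrow T_J$. -/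

import Mathlib

universe u v

namespace MinimalRingHom

/-- A ring homomorphism `f : R → T` is *minimal* if it is injective, not an isomorphism, and for
every factorization `f = g ∘ h` through a ring `S` which lies between `R` and `T` (that is, `g` is
injective; `h` is then injective because `f` is), one of `g`, `h` is an isomorphism. Since `S`
embeds in `T`, rings in the universe of `T` suffice. -/
structure IsMinimal {R : Type u} {T : Type v} [CommRing R] [CommRing T] (f : R →+* T) : Prop where
  injective : Function.Injective f
  not_bijective : ¬ Function.Bijective f
  factor : ∀ (S : Type v) [CommRing S] (h : R →+* S) (g : S →+* T), Function.Injective g →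
    g.comp h = f → Function.Bijective g ∨ Function.Bijective h

/-- `f : R → T` is an epimorphism of commutative rings: it is right cancellable. Two homomorphisms
out of `T` take values in the subring generated by the two images, so test rings `S` in the
universe of `T` suffice. -/
def IsEpimorphism {R : Type u} {T : Type v} [CommRing R] [CommRing T] (f : R →+* T) : Prop :=
  ∀ (S : Type v) [CommRing S] (g h : T →+* S), g.comp f = h.comp f → g = h

/-- `f : R → T` is a flat epimorphism. -/
def IsFlatEpimorphism {R : Type u} {T : Type v} [CommRing R] [CommRing T] (f : R →+* T) : Prop :=
  f.Flat ∧ IsEpimorphism f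

/-- `T_J`, the localization of `T` at (the image of) `R ∖ J`. -/
abbrev TLocalization {R : Type u} {T : Type v} [CommRing R] [CommRing T] (f : R →+* T)
    (J : Ideal R) [J.IsPrime] : Type v :=
  Localization (J.primeCompl.map f)

/-- The homomorphism `R_J → T_J` induced by `f : R → T`. -/
noncomputable def localizedHom {R : Type u} {T : Type v} [CommRing R] [CommRing T] (f : R →+* T)
    (J : Ideal R) [J.IsPrime] : Localization.AtPrime J →+* TLocalization f J :=
  IsLocalization.map (TLocalization f J) f J.primeCompl.le_comap_map

/-- The maximal ideal `J` of `R` is crucial for `f : R → T` if `R_J → T_J` is not an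
isomorphism. -/
def IsCrucial {R : Type u} {T : Type v} [CommRing R] [CommRing T] (f : R →+* T)
    (J : Ideal R) [J.IsMaximal] : Prop :=
  ¬ Function.Bijective (localizedHom f J)

/-- The conductor `(A : B) = {b ∈ B | b B ⊆ A}` of `f : A → B`, as an ideal of `B`, where `A` is
identified with its image in `B`. -/
def conductor {A : Type u} {B : Type v} [CommRing A] [CommRing B] (f : A →+* B) : Ideal B where
  carrier := {b | ∀ x : B, b * x ∈ f.range}
  zero_mem' := fun x => by rw [zero_mul]; exact f.range.zero_mem
  add_mem' := fun {a b} ha hb x => by rw [add_mul]; exact f.range.add_mem (ha x) (hb x)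
  smul_mem' := fun c b hb x => by
    have h := hb (c * x)
    rwa [show c • b * x = b * (c * x) by rw [smul_eq_mul]; ring]

/-- The conductor `(A : B)` as an ideal of `A`. -/
def conductorBelow {A : Type u} {B : Type v} [CommRing A] [CommRing B] (f : A →+* B) : Ideal A :=
  (conductor f).comap f

/-- The homomorphism `A / (A : B) → B / (A : B)` induced by `f : A → B`. -/
def conductorQuotientHom {A : Type u} {B : Type v} [CommRing A] [CommRing B] (f : A →+* B) :
    A ⧸ conductorBelow f →+* B ⧸ conductor f :=
  Ideal.quotientMap (conductor f) f le_rfl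

/-- `D` is a one-dimensional valuation ring: a valuation domain of Krull dimension one. -/
def IsOneDimValuationRing (D : Type u) [CommRing D] : Prop :=
  (∃ _ : IsDomain D, ValuationRing D) ∧ ringKrullDim D = 1

/-- `K` is the quotient field of `D` through the homomorphism `i : D → K`. -/
def IsQuotientField {D : Type u} {K : Type v} [CommRing D] [CommRing K] (i : D →+* K) : Prop :=
  letI : Algebra D K := i.toAlgebra
  IsDomain D ∧ IsFractionRing D K

end MinimalRingHom

/-!
Minimality says that the image of `R` is a maximal proper subring of `T`, and localizing at the
crucial ideal `J` gives a maximal subring `A = R_J` of `B = T_J`, with `A` local with maximal ideal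
`m`. Let `p = (A : B)`.

If `R → T` is a flat epimorphism, so is `A → B`; as it is not surjective it is not faithfully flat,
so `mB = B`. For `x ∉ p` maximality makes `A → B / xB` surjective, hence local unless `B / xB = 0`,
and `mB = B` excludes the first case: `x` is a unit of `B`. For `x ∈ m \ p` the ring
`⋃ₙ {b | xⁿ b ∈ A}` contains `x⁻¹ ∉ A`, so it is all of `B`. Hence `B / p` is the quotient field of
`A / p`, and `A / p` has dimension one. A valuation ring dominating `A / p` is not the whole field,
so by maximality it is `A / p`.

Conversely, by a criterion of Lazard, `R ⊆ T` is a flat epimorphism as soon as `(R : t) T = T` for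
all `t ∈ T`. If `B / p` is the quotient field of `A / p`, then no maximal ideal `J'` of `R` contains
`(R : t) T ∩ R`: for `J' = J` because `(R : t)` is not contained in `p`, whose complement becomes
invertible in `T_J`; for `J' ≠ J` because every `y ∈ J` satisfies `T = ⋃ₙ {t | yⁿ t ∈ R}`.
-/

namespace MinimalRingHom

section Subrings

variable {A : Type u} {B : Type v} [CommRing A] [CommRing B] {g : A →+* B}

theorem IsMinimal.isCoatom_range (hg : IsMinimal g) : IsCoatom g.range := by
  refine ⟨fun htop => hg.not_bijective ⟨hg.injective, RingHom.range_eq_top.mp htop⟩,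
    fun S hS => ?_⟩
  refine (hg.factor S (g.codRestrict S fun a => hS.le ⟨a, rfl⟩) S.subtype
    Subtype.val_injective rfl).elim (fun hsub => eq_top_iff.mpr fun b _ => ?_) fun hcod => ?_
  · obtain ⟨s, rfl⟩ := hsub.2 b
    exact s.2
  · refine absurd (fun b hb => ?_) hS.not_ge
    obtain ⟨a, ha⟩ := hcod.2 ⟨b, hb⟩
    exact ⟨a, congrArg Subtype.val ha⟩

theorem not_surjective_of_isCoatom_range (hg : IsCoatom g.range) : ¬ Function.Surjective g :=
  fun h => hg.1 (RingHom.range_eq_top.mpr h)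

/-- The ideal `(A : b) = {a ∈ A | a b ∈ A}` of denominators of an element `b` of `B`, for
`g : A → B`. -/
def denominators (g : A →+* B) (b : B) : Ideal A where
  carrier := {a | g a * b ∈ g.range}
  zero_mem' := ⟨0, by simp⟩
  add_mem' {a a'} ha ha' := by
    simpa only [Set.mem_ofPred_eq, map_add, add_mul] using add_mem ha ha'
  smul_mem' c a ha := by
    simpa only [Set.mem_ofPred_eq, smul_eq_mul, map_mul, mul_assoc] using
      mul_mem (g.mem_range_self c) ha

theorem mem_denominators {a : A} {b : B} : a ∈ denominators g b ↔ g a * b ∈ g.range :=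
  Iff.rfl

theorem mul_mem_denominators_mul {a a' : A} {b b' : B} (h : a ∈ denominators g b)
    (h' : a' ∈ denominators g b') : a * a' ∈ denominators g (b * b') := by
  rw [mem_denominators, map_mul, mul_mul_mul_comm]
  exact mul_mem h h'

/-- The saturation of `A` in `B` with respect to a submonoid `M` of `A`: the elements of `B` that
have a denominator in `M`, i.e. the preimage in `B` of `M⁻¹A ⊆ M⁻¹B`. -/
def saturation (g : A →+* B) (M : Submonoid A) : Subring B where
  carrier := {b | ∃ s ∈ M, s ∈ denominators g b}
  one_mem' := ⟨1, M.one_mem, 1, by simp⟩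
  zero_mem' := ⟨1, M.one_mem, 0, by simp⟩
  mul_mem' := fun ⟨s, hs, hb⟩ ⟨s', hs', hb'⟩ =>
    ⟨s * s', M.mul_mem hs hs', mul_mem_denominators_mul hb hb'⟩
  add_mem' := fun ⟨s, hs, hb⟩ ⟨s', hs', hb'⟩ => ⟨s * s', M.mul_mem hs hs', by
    rw [mem_denominators, mul_add]
    exact add_mem (Ideal.mul_mem_right s' _ hb) (Ideal.mul_mem_left _ s hb')⟩
  neg_mem' := fun ⟨s, hs, hb⟩ => ⟨s, hs, by
    rw [mem_denominators, mul_neg]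
    exact neg_mem hb⟩

theorem range_le_saturation (M : Submonoid A) : g.range ≤ saturation g M :=
  fun _ hb => ⟨1, M.one_mem, by simpa [mem_denominators] using hb⟩

end Subrings

section Conductor

variable {A : Type u} {B : Type v} [CommRing A] [CommRing B] {g : A →+* B}

theorem mem_conductorBelow {a : A} : a ∈ conductorBelow g ↔ ∀ b, a ∈ denominators g b :=
  Iff.rfl

theorem conductor_le_range {b : B} (hb : b ∈ conductor g) : b ∈ g.range := by
  simpa using hb 1

theorem le_conductor {I : Ideal B} (hI : ∀ b ∈ I, b ∈ g.range) : I ≤ conductor g :=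
  fun _ hb x => hI _ (I.mul_mem_right x hb)

theorem conductor_ne_top (hg : ¬ Function.Surjective g) : conductor g ≠ ⊤ :=
  fun htop => hg fun _ => conductor_le_range (htop ▸ Submodule.mem_top)

theorem mk_comp_surjective (hg : IsCoatom g.range) {I : Ideal B} (hI : ¬ I ≤ conductor g) :
    Function.Surjective ((Ideal.Quotient.mk I).comp g) := by
  let S := ((Ideal.Quotient.mk I).comp g).range.comap (Ideal.Quotient.mk I)
  have hgS : g.range ≤ S := by
    rintro _ ⟨a, rfl⟩
    exact ⟨a, rfl⟩
  have hSne : S ≠ g.range := fun hS => hI <| le_conductor fun b hb => hS ▸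
    ⟨0, by rw [map_zero, Ideal.Quotient.eq_zero_iff_mem.mpr hb]⟩
  intro e
  obtain ⟨b, rfl⟩ := Ideal.Quotient.mk_surjective e
  exact ((hg.le_iff.mp hgS).resolve_right hSne ▸ Subring.mem_top b : b ∈ S)

theorem exists_mem_notMem_conductorBelow (hg : ¬ Function.Surjective g) {I : Ideal A}
    (hI : I.map g = ⊤) : ∃ x ∈ I, x ∉ conductorBelow g := by
  by_contra! hle
  exact conductor_ne_top hg (top_le_iff.mp (hI ▸ Ideal.map_le_iff_le_comap.mpr hle))

theorem isPrime_conductorBelow (hg : IsCoatom g.range) : (conductorBelow g).IsPrime := by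
  refine ⟨fun htop => ?_, fun {x y} hxy => or_iff_not_imp_left.mpr fun hx b => ?_⟩
  · exact conductor_ne_top (not_surjective_of_isCoatom_range hg) (Ideal.comap_eq_top_iff.mp htop)
  · obtain ⟨a, ha⟩ := mk_comp_surjective hg
      (mt (Ideal.span_singleton_le_iff_mem _).mp hx) (Ideal.Quotient.mk _ b)
    obtain ⟨c, hc⟩ := Ideal.mem_span_singleton.mp (Ideal.Quotient.eq.mp (Eq.symm ha))
    have hb : g y * b = g (y * a) + g (x * y) * c := by
      simp only [map_mul]
      linear_combination g y * hc
    exact hb ▸ add_mem (g.mem_range_self _) (hxy c)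

theorem conductorQuotientHom_mk (a : A) :
    conductorQuotientHom g (Ideal.Quotient.mk _ a) = Ideal.Quotient.mk _ (g a) :=
  Ideal.quotientMap_mk

theorem conductorQuotientHom_injective : Function.Injective (conductorQuotientHom g) :=
  Ideal.quotientMap_injective

theorem comap_range_conductorQuotientHom :
    (conductorQuotientHom g).range.comap (Ideal.Quotient.mk (conductor g)) = g.range := by
  ext b
  refine ⟨?_, ?_⟩
  · rintro ⟨d, hd⟩
    obtain ⟨a, rfl⟩ := Ideal.Quotient.mk_surjective d
    rw [conductorQuotientHom_mk, Ideal.Quotient.eq] at hd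
    simpa using sub_mem (g.mem_range_self a) (conductor_le_range hd)
  · rintro ⟨a, rfl⟩
    exact ⟨Ideal.Quotient.mk _ a, conductorQuotientHom_mk a⟩

theorem isCoatom_range_conductorQuotientHom (hg : IsCoatom g.range) :
    IsCoatom (conductorQuotientHom g).range := by
  refine ((Subring.gc_map_comap _).toGaloisInsertion fun S =>
    (Subring.map_comap_eq_self_of_surjective (Ideal.Quotient.mk_surjective (I := conductor g))
      S).ge).isCoatom_of_image ?_
  rwa [comap_range_conductorQuotientHom]

end Conductor

section ValuationRing

theorem valuationRing_of_isCoatom_range {D : Type*} {K : Type*} [CommRing D] [IsDomain D]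
    [IsLocalRing D] [Field K] {i : D →+* K} (hi : Function.Injective i) (hD : ¬ IsField D)
    (h : IsCoatom i.range) : ValuationRing D := by
  obtain ⟨V, hV, hlocal⟩ := IsLocalRing.exists_factor_valuationRing i
  have hle : i.range ≤ V.toSubring := by
    rintro _ ⟨x, rfl⟩
    exact hV x
  -- A nonzero `x` in the maximal ideal has no inverse in `V`, because `V` dominates `D`.
  have hVtop : V.toSubring ≠ ⊤ := fun htop => hD <| by
    refine IsLocalRing.isField_iff_maximalIdeal_eq.mpr (eq_bot_iff.mpr fun x hx => ?_)
    by_contra hx0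
    have hinv : (i x)⁻¹ ∈ V.toSubring := htop ▸ Subring.mem_top _
    have hunit : IsUnit (i.codRestrict V.toSubring hV x) :=
      .of_mul_eq_one ⟨_, hinv⟩ <| Subtype.ext <|
        mul_inv_cancel₀ ((map_ne_zero_iff i hi).mpr hx0)
    exact (IsLocalRing.mem_maximalIdeal x).mp hx (hlocal.map_nonunit x hunit)
  have hVi : V.toSubring = i.range := (h.le_iff_eq hVtop).mp hle
  have hdvd (a b : D) (hb : b ≠ 0) (hab : i a / i b ∈ V.toSubring) : b ∣ a := by
    obtain ⟨c, hc⟩ := hVi ▸ hab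
    refine ⟨c, hi ?_⟩
    rw [map_mul, hc, mul_div_cancel₀ _ ((map_ne_zero_iff i hi).mpr hb)]
  refine ValuationRing.iff_dvd_total.mpr ⟨fun a b => ?_⟩
  obtain rfl | ha := eq_or_ne a 0
  · exact .inr (dvd_zero b)
  obtain rfl | hb := eq_or_ne b 0
  · exact .inl (dvd_zero a)
  exact (V.mem_or_inv_mem (i a / i b)).symm.imp
    (fun hab => hdvd b a ha (inv_div (i a) (i b) ▸ hab)) (hdvd a b hb)

end ValuationRing

section FlatEpimorphism

open TensorProduct

variable {A : Type u} {B : Type v} [CommRing A] [CommRing B]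

theorem IsEpimorphism.surjective_of_faithfullyFlat [Algebra A B] [Module.FaithfullyFlat A B]
    (h : IsEpimorphism (algebraMap A B)) : Function.Surjective (algebraMap A B) := by
  have heq := h (B ⊗[A] B)
    (Algebra.TensorProduct.includeLeft : B →ₐ[A] B ⊗[A] B).toRingHom
    (Algebra.TensorProduct.includeRight : B →ₐ[A] B ⊗[A] B).toRingHom (by ext x; simp)
  intro b
  have hb : b ∈ Set.range (algebraMap A B) := by
    rw [← (Algebra.IsEffective.of_faithfullyFlat A B).eqLocus_includeLeft_includeRight]
    exact RingHom.congr_fun heq b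
  exact hb

variable {g : A →+* B}

theorem IsFlatEpimorphism.map_maximalIdeal_eq_top [IsLocalRing A] (hg : IsFlatEpimorphism g)
    (hsurj : ¬ Function.Surjective g) : (IsLocalRing.maximalIdeal A).map g = ⊤ := by
  let := g.toAlgebra
  by_contra hne
  have : Module.Flat A B := hg.1
  have : Module.FaithfullyFlat A B := ⟨fun m hm => by
    rwa [IsLocalRing.eq_maximalIdeal hm, Ideal.smul_top_eq_map, Ne,
      Submodule.restrictScalars_eq_top_iff]⟩
  exact hsurj (IsEpimorphism.surjective_of_faithfullyFlat hg.2)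

end FlatEpimorphism

section LocalSource

open IsLocalRing

variable {A : Type u} {B : Type v} [CommRing A] [CommRing B] [IsLocalRing A] {g : A →+* B}

theorem isUnit_of_notMem_conductorBelow (hg : IsCoatom g.range)
    (hm : (maximalIdeal A).map g = ⊤) {x : A} (hx : x ∉ conductorBelow g) : IsUnit (g x) := by
  rw [← Ideal.span_singleton_eq_top]
  by_contra hne
  have : Nontrivial (B ⧸ Ideal.span {g x}) := Ideal.Quotient.nontrivial_iff.mpr hne
  let φ := (Ideal.Quotient.mk (Ideal.span {g x})).comp g
  have hφ : Function.Surjective φ :=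
    mk_comp_surjective hg (mt (Ideal.span_singleton_le_iff_mem _).mp hx)
  have hmφ : (maximalIdeal A).map φ = ⊤ := by
    rw [← Ideal.map_map, hm, Ideal.map_top]
  obtain ⟨y, hy, hy1⟩ := (Ideal.mem_map_iff_of_surjective φ hφ).mp
    ((Ideal.eq_top_iff_one _).mp hmφ)
  have : IsLocalHom φ := .of_surjective φ hφ
  exact (mem_maximalIdeal y).mp hy (isUnit_of_map_unit φ y (hy1 ▸ isUnit_one))

theorem saturation_powers_eq_top (hg : IsCoatom g.range) (hm : (maximalIdeal A).map g = ⊤)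
    {x : A} (hxm : x ∈ maximalIdeal A) (hx : x ∉ conductorBelow g) :
    saturation g (.powers x) = ⊤ := by
  refine (hg.le_iff.mp (range_le_saturation _)).resolve_right fun hrange => ?_
  obtain ⟨u, hu⟩ := (isUnit_of_notMem_conductorBelow hg hm hx).exists_right_inv
  have hus : u ∈ saturation g (.powers x) :=
    ⟨x, Submonoid.mem_powers x, mem_denominators.mpr (hu ▸ one_mem _)⟩
  obtain ⟨a, rfl⟩ := hrange ▸ hus
  have hp := isPrime_conductorBelow hg
  -- `u = x⁻¹` in `A` would make `1 = x a + (1 - x a)` an element of the maximal ideal.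
  have hsub : 1 - x * a ∈ conductorBelow g := by
    rw [conductorBelow, Ideal.mem_comap, map_sub, map_mul, hu, map_one, sub_self]
    exact zero_mem _
  refine (maximalIdeal.isMaximal A).ne_top ((Ideal.eq_top_iff_one _).mpr ?_)
  simpa using add_mem (le_maximalIdeal hp.ne_top hsub) (Ideal.mul_mem_right a _ hxm)

theorem isQuotientField_conductorQuotientHom (hg : IsCoatom g.range)
    (hm : (maximalIdeal A).map g = ⊤) : IsQuotientField (conductorQuotientHom g) := by
  let := (conductorQuotientHom g).toAlgebra
  have hp := isPrime_conductorBelow hg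
  refine ⟨inferInstance, ⟨?_, ?_, ?_⟩⟩
  · rintro ⟨d, hd⟩
    obtain ⟨x, rfl⟩ := Ideal.Quotient.mk_surjective d
    have hx : x ∉ conductorBelow g :=
      mt Ideal.Quotient.eq_zero_iff_mem.mpr (nonZeroDivisors.ne_zero hd)
    rw [RingHom.algebraMap_toAlgebra, conductorQuotientHom_mk]
    exact (isUnit_of_notMem_conductorBelow hg hm hx).map _
  · intro e
    obtain ⟨b, rfl⟩ := Ideal.Quotient.mk_surjective e
    obtain ⟨x, hxm, hx⟩ := exists_mem_notMem_conductorBelow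
      (not_surjective_of_isCoatom_range hg) hm
    obtain ⟨_, ⟨n, rfl⟩, a, ha⟩ : b ∈ saturation g (.powers x) :=
      saturation_powers_eq_top hg hm hxm hx ▸ Subring.mem_top b
    have hxn : Ideal.Quotient.mk (conductorBelow g) (x ^ n) ≠ 0 :=
      mt Ideal.Quotient.eq_zero_iff_mem.mp (mt (hp.mem_of_pow_mem n) hx)
    refine ⟨(Ideal.Quotient.mk _ a, ⟨_, mem_nonZeroDivisors_of_ne_zero hxn⟩), ?_⟩
    simp only [RingHom.algebraMap_toAlgebra, conductorQuotientHom_mk, ha, map_mul, mul_comm]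
  · exact fun h => ⟨1, by rw [conductorQuotientHom_injective h]⟩

theorem exists_pow_mem_sup_conductorBelow (hg : IsCoatom g.range)
    (hm : (maximalIdeal A).map g = ⊤) {a x : A} (ha : a ∉ conductorBelow g)
    (hx : x ∈ maximalIdeal A) : ∃ n, x ^ n ∈ Ideal.span {a} ⊔ conductorBelow g := by
  by_cases hxp : x ∈ conductorBelow g
  · exact ⟨1, by rw [pow_one]; exact Ideal.mem_sup_right hxp⟩
  obtain ⟨u, hu⟩ := (isUnit_of_notMem_conductorBelow hg hm ha).exists_right_inv
  obtain ⟨_, ⟨n, rfl⟩, c, hc⟩ : u ∈ saturation g (.powers x) :=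
    saturation_powers_eq_top hg hm hx hxp ▸ Subring.mem_top u
  have hsub : x ^ n - a * c ∈ conductorBelow g := by
    have hzero : g (x ^ n - a * c) = 0 := by
      rw [map_sub, map_mul, hc]
      linear_combination -g (x ^ n) * hu
    exact Ideal.mem_comap.mpr (hzero ▸ zero_mem _)
  exact ⟨n, Submodule.mem_sup.mpr
    ⟨a * c, Ideal.mem_span_singleton.mpr (dvd_mul_right a c), _, hsub, add_sub_cancel _ _⟩⟩

theorem isOneDimValuationRing_quotient_conductorBelow (hg : IsCoatom g.range)
    (hm : (maximalIdeal A).map g = ⊤) : IsOneDimValuationRing (A ⧸ conductorBelow g) := by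
  have hp := isPrime_conductorBelow hg
  have : IsLocalRing (A ⧸ conductorBelow g) :=
    .of_surjective' (Ideal.Quotient.mk _) Ideal.Quotient.mk_surjective
  have hfield : ¬ IsField (A ⧸ conductorBelow g) := fun h => by
    obtain ⟨x, hxm, hx⟩ := exists_mem_notMem_conductorBelow
      (not_surjective_of_isCoatom_range hg) hm
    exact hx (eq_maximalIdeal (Ideal.Quotient.maximal_of_isField _ h) ▸ hxm)
  refine ⟨⟨inferInstance, ?_⟩, ringKrullDim_eq_one_iff_of_isLocalRing_isDomain.mpr
    ⟨hfield, fun d hd e he => ?_⟩⟩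
  · let := (conductorQuotientHom g).toAlgebra
    have := (isQuotientField_conductorQuotientHom hg hm).2
    let := IsFractionRing.toField (A ⧸ conductorBelow g) (K := B ⧸ conductor g)
    exact valuationRing_of_isCoatom_range conductorQuotientHom_injective hfield
      (isCoatom_range_conductorQuotientHom hg)
  · obtain ⟨a, rfl⟩ := Ideal.Quotient.mk_surjective d
    obtain ⟨x, rfl⟩ := Ideal.Quotient.mk_surjective e
    have hx : x ∈ maximalIdeal A := (mem_maximalIdeal x).mpr fun h =>
      (mem_maximalIdeal _).mp he (h.map (Ideal.Quotient.mk (conductorBelow g)))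
    obtain ⟨n, hn⟩ := exists_pow_mem_sup_conductorBelow hg hm
      (mt Ideal.Quotient.eq_zero_iff_mem.mpr hd) hx
    refine ⟨n, ?_⟩
    have hmap := Ideal.mem_map_of_mem (Ideal.Quotient.mk (conductorBelow g)) hn
    rwa [Ideal.map_sup, Ideal.map_quotient_self, sup_bot_eq, Ideal.map_span, Set.image_singleton,
      map_pow] at hmap

end LocalSource

section QuotientField

variable {A : Type u} {B : Type v} [CommRing A] [CommRing B] {g : A →+* B}

theorem conductor_le_jacobson_bot [IsLocalRing A] (hg : conductorBelow g ≠ ⊤) :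
    conductor g ≤ Ideal.jacobson ⊥ := by
  refine fun b hb => Ideal.mem_jacobson_bot.mpr fun x => ?_
  obtain ⟨c, hc⟩ := hb x
  have hcp : c ∈ conductorBelow g := by
    rw [conductorBelow, Ideal.mem_comap, hc]
    exact Ideal.mul_mem_right x _ hb
  have hunit : IsUnit (c + 1) := by
    by_contra h
    refine (IsLocalRing.maximalIdeal.isMaximal A).ne_top ((Ideal.eq_top_iff_one _).mpr ?_)
    simpa using sub_mem ((IsLocalRing.mem_maximalIdeal _).mpr h)
      (IsLocalRing.le_maximalIdeal hg hcp)
  rw [← hc, ← map_one g, ← map_add]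
  exact hunit.map g

theorem IsQuotientField.isUnit_of_notMem_conductorBelow [IsLocalRing A]
    (h : IsQuotientField (conductorQuotientHom g)) {x : A} (hx : x ∉ conductorBelow g) :
    IsUnit (g x) := by
  let := (conductorQuotientHom g).toAlgebra
  obtain ⟨hD, hK⟩ := h
  have := isLocalHom_of_le_jacobson_bot (conductor g)
    (conductor_le_jacobson_bot fun htop => hx (htop ▸ Submodule.mem_top))
  refine isUnit_of_map_unit (Ideal.Quotient.mk (conductor g)) _ ?_
  rw [← conductorQuotientHom_mk]
  exact IsLocalization.map_units (B ⧸ conductor g)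
    (⟨_, mem_nonZeroDivisors_of_ne_zero (mt Ideal.Quotient.eq_zero_iff_mem.mp hx)⟩ :
      nonZeroDivisors (A ⧸ conductorBelow g))

theorem IsQuotientField.exists_mem_denominators (h : IsQuotientField (conductorQuotientHom g))
    (b : B) : ∃ x ∉ conductorBelow g, x ∈ denominators g b := by
  let := (conductorQuotientHom g).toAlgebra
  obtain ⟨hD, hK⟩ := h
  obtain ⟨⟨a, s, hs⟩, hbs⟩ := IsLocalization.surj (nonZeroDivisors (A ⧸ conductorBelow g))
    (Ideal.Quotient.mk (conductor g) b)
  obtain ⟨x, rfl⟩ := Ideal.Quotient.mk_surjective s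
  refine ⟨x, mt Ideal.Quotient.eq_zero_iff_mem.mpr (nonZeroDivisors.ne_zero hs), ?_⟩
  rw [mem_denominators, ← comap_range_conductorQuotientHom, Subring.mem_comap, map_mul,
    ← conductorQuotientHom_mk, mul_comm]
  exact ⟨a, hbs.symm⟩

end QuotientField

section Localization

variable {R : Type u} {T : Type v} [CommRing R] [CommRing T] {f : R →+* T} {J : Ideal R}
  [J.IsPrime]

theorem localizedHom_algebraMap (r : R) :
    localizedHom f J (algebraMap R _ r) = algebraMap T _ (f r) :=
  IsLocalization.map_eq J.primeCompl.le_comap_map r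

theorem localizedHom_comp :
    (localizedHom f J).comp (algebraMap R _) = (algebraMap T (TLocalization f J)).comp f :=
  RingHom.ext localizedHom_algebraMap

theorem algebraMap_mem_range_localizedHom (r : R) :
    algebraMap T _ (f r) ∈ (localizedHom f J).range :=
  ⟨algebraMap R _ r, localizedHom_algebraMap r⟩

theorem exists_mem_range_mul_algebraMap_eq_one {s : R} (hs : s ∉ J) :
    ∃ w ∈ (localizedHom f J).range, w * algebraMap T _ (f s) = 1 := by
  obtain ⟨w, hw⟩ := (IsLocalization.map_units (Localization.AtPrime J)
    (⟨s, hs⟩ : J.primeCompl)).exists_left_inv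
  exact ⟨_, ⟨w, rfl⟩, by rw [← localizedHom_algebraMap, ← map_mul, hw, map_one]⟩

theorem le_of_comap_algebraMap_le {S S' : Subring (TLocalization f J)}
    (hS : (localizedHom f J).range ≤ S) (hS' : (localizedHom f J).range ≤ S')
    (h : S.comap (algebraMap T _) ≤ S'.comap (algebraMap T _)) : S ≤ S' := by
  intro b hb
  obtain ⟨⟨t, _, s, hs, rfl⟩, hbt⟩ := IsLocalization.surj (J.primeCompl.map f) b
  obtain ⟨w, hw, hws⟩ := exists_mem_range_mul_algebraMap_eq_one (f := f) hs
  have ht : algebraMap T _ t ∈ S' :=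
    h (hbt ▸ mul_mem hb (hS (algebraMap_mem_range_localizedHom s)) : algebraMap T _ t ∈ S)
  have hbw : b = algebraMap T _ t * w := by
    linear_combination w * hbt - b * hws
  exact hbw ▸ mul_mem ht (hS' hw)

theorem comap_range_localizedHom :
    (localizedHom f J).range.comap (algebraMap T _) = saturation f J.primeCompl := by
  refine le_antisymm ?_ ?_
  · rintro t ⟨a, ha⟩
    obtain ⟨⟨r, s, hs⟩, has⟩ := IsLocalization.surj J.primeCompl a
    have hst : algebraMap T (TLocalization f J) (f s * t) = algebraMap T _ (f r) := by
      rw [← localizedHom_algebraMap, ← has, map_mul, map_mul, ha, localizedHom_algebraMap,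
        mul_comm]
    obtain ⟨⟨_, c, hc, rfl⟩, hcst⟩ :=
      (IsLocalization.eq_iff_exists (J.primeCompl.map f) _).mp hst
    refine ⟨c * s, J.primeCompl.mul_mem hc hs, c * r, ?_⟩
    rw [map_mul, map_mul, mul_assoc, hcst]
  · rintro t ⟨s, hs, r, hr⟩
    obtain ⟨w, hw, hws⟩ := exists_mem_range_mul_algebraMap_eq_one (f := f) hs
    have htw : algebraMap T (TLocalization f J) t = w * algebraMap T _ (f r) := by
      rw [hr, map_mul, ← mul_assoc, hws, one_mul]
    exact Subring.mem_comap.mpr (htw ▸ mul_mem hw (algebraMap_mem_range_localizedHom r))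

theorem saturation_primeCompl_eq_range (hf : IsCoatom f.range)
    (hJ : ¬ Function.Surjective (localizedHom f J)) :
    saturation f J.primeCompl = f.range := by
  refine (hf.le_iff_eq fun htop => hJ (RingHom.range_eq_top.mp ?_)).mp (range_le_saturation _)
  rw [← comap_range_localizedHom] at htop
  exact top_le_iff.mp (le_of_comap_algebraMap_le le_top le_rfl htop.ge)

theorem isCoatom_range_localizedHom (hf : IsCoatom f.range)
    (hJ : ¬ Function.Surjective (localizedHom f J)) : IsCoatom (localizedHom f J).range := by
  have hcomap : (localizedHom f J).range.comap (algebraMap T _) = f.range :=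
    comap_range_localizedHom.trans (saturation_primeCompl_eq_range hf hJ)
  refine ⟨fun htop => hJ (RingHom.range_eq_top.mp htop), fun S hS => ?_⟩
  have hle : f.range ≤ S.comap (algebraMap T _) :=
    hcomap ▸ fun _ ht => hS.le ht
  refine (hf.le_iff.mp hle).elim (fun htop => ?_) fun heq => ?_
  · exact top_le_iff.mp (le_of_comap_algebraMap_le le_top hS.le htop.ge)
  · exact absurd (le_of_comap_algebraMap_le hS.le le_rfl (hcomap ▸ heq.le)) hS.not_ge

theorem IsEpimorphism.localizedHom (h : IsEpimorphism f) : IsEpimorphism (localizedHom f J) := by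
  intro S _ φ ψ hφ
  refine IsLocalization.ringHom_ext (J.primeCompl.map f) (h S _ _ ?_)
  rw [RingHom.comp_assoc, RingHom.comp_assoc, ← localizedHom_comp, ← RingHom.comp_assoc, hφ,
    RingHom.comp_assoc]

theorem flat_localizedHom (h : f.Flat) : (localizedHom f J).Flat := by
  let := ((algebraMap T (TLocalization f J)).comp f).toAlgebra
  let := (localizedHom f J).toAlgebra
  have : IsScalarTower R (Localization.AtPrime J) (TLocalization f J) :=
    .of_algebraMap_eq' localizedHom_comp.symm
  have hT : (algebraMap T (TLocalization f J)).Flat :=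
    RingHom.flat_algebraMap_iff.mpr (IsLocalization.flat _ (J.primeCompl.map f))
  exact (Module.flat_iff_of_isLocalization (Localization.AtPrime J) J.primeCompl _).mpr (h.comp hT)

theorem IsFlatEpimorphism.localizedHom (h : IsFlatEpimorphism f) :
    IsFlatEpimorphism (localizedHom f J) :=
  ⟨flat_localizedHom h.1, h.2.localizedHom⟩

theorem algebraMap_mem_denominators_iff (hf : IsCoatom f.range)
    (hJ : ¬ Function.Surjective (localizedHom f J)) {r : R} {t : T} :
    algebraMap R _ r ∈ denominators (localizedHom f J) (algebraMap T _ t) ↔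
      r ∈ denominators f t := by
  rw [mem_denominators, localizedHom_algebraMap, ← map_mul, ← Subring.mem_comap,
    comap_range_localizedHom, saturation_primeCompl_eq_range hf hJ, mem_denominators]

theorem IsQuotientField.exists_mem_denominators_of_localizedHom
    (hq : IsQuotientField (conductorQuotientHom (localizedHom f J))) (hf : IsCoatom f.range)
    (hJ : ¬ Function.Surjective (localizedHom f J)) (t : T) :
    ∃ r ∈ denominators f t, algebraMap R _ r ∉ conductorBelow (localizedHom f J) := by
  obtain ⟨x, hx, hxt⟩ := hq.exists_mem_denominators (algebraMap T _ t)
  obtain ⟨⟨r, s⟩, hxs⟩ := IsLocalization.surj J.primeCompl x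
  have hs := IsLocalization.map_units (Localization.AtPrime J) s
  refine ⟨r, (algebraMap_mem_denominators_iff hf hJ).mp ?_, ?_⟩
  · exact hxs ▸ Ideal.mul_mem_right _ _ hxt
  · rwa [← hxs, Ideal.mul_unit_mem_iff_mem _ hs]

theorem IsQuotientField.exists_dvd_of_localizedHom
    (hq : IsQuotientField (conductorQuotientHom (localizedHom f J))) {r : R}
    (hr : algebraMap R _ r ∉ conductorBelow (localizedHom f J)) : ∃ s ∉ J, f r ∣ f s := by
  have hunit := hq.isUnit_of_notMem_conductorBelow hr
  rw [localizedHom_algebraMap, IsLocalization.algebraMap_isUnit_iff (J.primeCompl.map f)] at hunit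
  obtain ⟨_, ⟨s, hs, rfl⟩, hrs⟩ := hunit
  exact ⟨s, hs, hrs⟩

theorem IsQuotientField.saturation_powers_eq_top_of_localizedHom
    (hq : IsQuotientField (conductorQuotientHom (localizedHom f J))) (hf : IsCoatom f.range)
    (hinj : Function.Injective f) (hJ : ¬ Function.Surjective (localizedHom f J)) {y : R}
    (hy : y ∈ J) : saturation f (.powers y) = ⊤ := by
  by_cases hyp : algebraMap R _ y ∈ conductorBelow (localizedHom f J)
  · exact top_le_iff.mp fun t _ => ⟨y, Submonoid.mem_powers y,
      (algebraMap_mem_denominators_iff hf hJ).mp (mem_conductorBelow.mp hyp _)⟩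
  · refine (hf.le_iff.mp (range_le_saturation _)).resolve_right fun hrange => ?_
    obtain ⟨s, hs, t, hst⟩ := hq.exists_dvd_of_localizedHom hyp
    have ht : t ∈ saturation f (.powers y) :=
      ⟨y, Submonoid.mem_powers y, mem_denominators.mpr (hst ▸ f.mem_range_self s)⟩
    obtain ⟨r, rfl⟩ := hrange ▸ ht
    have hsr : s = y * r := hinj (hst.trans (map_mul f y r).symm)
    exact hs (hsr ▸ J.mul_mem_right r hy)

end Localization

section CrucialIdeal

variable {R : Type u} {T : Type v} [CommRing R] [CommRing T] {f : R →+* T} {J : Ideal R}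
  [J.IsMaximal]

theorem IsCrucial.not_surjective (hinj : Function.Injective f) (hJ : IsCrucial f J) :
    ¬ Function.Surjective (localizedHom f J) :=
  fun h => hJ ⟨IsLocalization.map_injective_of_injective _ _ _ hinj, h⟩

theorem IsQuotientField.map_denominators_eq_top
    (hq : IsQuotientField (conductorQuotientHom (localizedHom f J))) (hf : IsCoatom f.range)
    (hinj : Function.Injective f) (hJ : ¬ Function.Surjective (localizedHom f J)) (t : T) :
    (denominators f t).map f = ⊤ := by
  rw [← Ideal.comap_eq_top_iff (f := f)]
  by_contra hne
  obtain ⟨J', hJ', hle⟩ := Ideal.exists_le_maximal _ hne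
  have hJJ' : ¬ J ≤ J' := fun hJle => by
    obtain rfl := Ideal.IsMaximal.eq_of_le inferInstance hJ'.ne_top hJle
    obtain ⟨r, hrt, hr⟩ := hq.exists_mem_denominators_of_localizedHom hf hJ t
    obtain ⟨s, hs, hrs⟩ := hq.exists_dvd_of_localizedHom hr
    exact hs (hle (Ideal.mem_comap.mpr (Ideal.mem_of_dvd _ hrs (Ideal.mem_map_of_mem f hrt))))
  obtain ⟨y, hy, hy'⟩ := SetLike.not_le_iff_exists.mp hJJ'
  obtain ⟨_, ⟨n, rfl⟩, hyt⟩ : t ∈ saturation f (.powers y) :=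
    hq.saturation_powers_eq_top_of_localizedHom hf hinj hJ hy ▸ Subring.mem_top t
  exact hy' (hJ'.isPrime.mem_of_pow_mem n (hle (Ideal.le_comap_map hyt)))

end CrucialIdeal

section Denominators

variable {R : Type u} {T : Type v} [CommRing R] [CommRing T] {f : R →+* T}

theorem isEpimorphism_of_map_denominators_eq_top (h : ∀ t, (denominators f t).map f = ⊤) :
    IsEpimorphism f := by
  intro S _ φ ψ hφ
  refine RingHom.ext fun t => sub_eq_zero.mp ?_
  let I : Ideal T := ((⊥ : Ideal S).colon {φ t - ψ t}).comap φ
  have hI {x : T} : x ∈ I ↔ φ x * (φ t - ψ t) = 0 := by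
    simp [I, Submodule.mem_colon_singleton]
  have hle : (denominators f t).map f ≤ I := Ideal.map_le_iff_le_comap.mpr fun r ⟨c, hc⟩ => by
    have hfr (r : R) : φ (f r) = ψ (f r) := RingHom.congr_fun hφ r
    have hrt : φ (f r * t) = ψ (f r * t) := by rw [← hc, hfr]
    rw [map_mul, map_mul, ← hfr] at hrt
    exact hI.mpr (by rw [mul_sub, hrt, sub_self])
  simpa using hI.mp (hle (h t ▸ Submodule.mem_top : (1 : T) ∈ _))

theorem isLocalization_atPrime_of_map_denominators_eq_top [Algebra R T]
    (hinj : Function.Injective (algebraMap R T))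
    (h : ∀ t, (denominators (algebraMap R T) t).map (algebraMap R T) = ⊤)
    (P : Ideal T) [P.IsPrime] :
    IsLocalization (P.comap (algebraMap R T)).primeCompl (Localization.AtPrime P) := by
  have hden (t : T) : ∃ r ∈ denominators (algebraMap R T) t, algebraMap R T r ∉ P := by
    by_contra! hle
    exact Ideal.IsPrime.ne_top' (top_le_iff.mp (h t ▸ Ideal.map_le_iff_le_comap.mpr hle))
  have halg (r : R) :
      algebraMap R (Localization.AtPrime P) r = algebraMap T _ (algebraMap R T r) :=
    IsScalarTower.algebraMap_apply R T _ r
  refine ⟨fun s => ?_, fun e => ?_, fun {x y} hxy => ?_⟩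
  · rw [halg]
    exact IsLocalization.map_units _ (⟨_, s.2⟩ : P.primeCompl)
  · obtain ⟨⟨t, v, hv⟩, hev⟩ := IsLocalization.surj P.primeCompl e
    obtain ⟨r, hrt, hr⟩ := hden t
    obtain ⟨r', hrv, hr'⟩ := hden v
    obtain ⟨a, ha⟩ := Ideal.mul_mem_right r' _ hrt
    obtain ⟨b, hb⟩ := Ideal.mul_mem_left _ r hrv
    have hbP : algebraMap R T b ∉ P := by
      rw [hb, map_mul]
      exact P.primeCompl.mul_mem (P.primeCompl.mul_mem hr hr') hv
    refine ⟨(a, ⟨b, hbP⟩), ?_⟩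
    simp only [halg, ha, hb, map_mul]
    rw [← hev]
    ring
  · rw [halg, halg] at hxy
    obtain ⟨⟨v, hv⟩, hvxy⟩ := (IsLocalization.eq_iff_exists P.primeCompl _).mp hxy
    obtain ⟨r, ⟨c, hc⟩, hr⟩ := hden v
    have hcP : algebraMap R T c ∉ P := hc ▸ P.primeCompl.mul_mem hr hv
    refine ⟨⟨c, hcP⟩, hinj ?_⟩
    rw [map_mul, map_mul, hc, mul_assoc, hvxy, mul_assoc]

theorem flat_of_map_denominators_eq_top (hinj : Function.Injective f)
    (h : ∀ t, (denominators f t).map f = ⊤) : f.Flat := by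
  let := f.toAlgebra
  refine Module.flat_of_isLocalized_maximal (R := R) T T (fun P => Localization.AtPrime P)
    (fun P => Algebra.linearMap T (Localization.AtPrime P)) fun P _ => ?_
  have := isLocalization_atPrime_of_map_denominators_eq_top hinj h P
  exact IsLocalization.flat _ (P.comap (algebraMap R T)).primeCompl

theorem isFlatEpimorphism_of_map_denominators_eq_top (hinj : Function.Injective f)
    (h : ∀ t, (denominators f t).map f = ⊤) : IsFlatEpimorphism f :=
  ⟨flat_of_map_denominators_eq_top hinj h, isEpimorphism_of_map_denominators_eq_top h⟩

end Denominators

end MinimalRingHom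

theorem theorem3p6 {R : Type u} {T : Type v} [CommRing R] [CommRing T] (f : R →+* T)
    (hf : MinimalRingHom.IsMinimal f) (J : Ideal R) [J.IsMaximal]
    (hJ : MinimalRingHom.IsCrucial f J) :
    MinimalRingHom.IsFlatEpimorphism f ↔
      MinimalRingHom.IsOneDimValuationRing
          (Localization.AtPrime J ⧸
            MinimalRingHom.conductorBelow (MinimalRingHom.localizedHom f J)) ∧
        MinimalRingHom.IsQuotientField
          (MinimalRingHom.conductorQuotientHom (MinimalRingHom.localizedHom f J)) := by
  have hnot := hJ.not_surjective hf.injective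
  have hcoatom := MinimalRingHom.isCoatom_range_localizedHom hf.isCoatom_range hnot
  refine ⟨fun h => ?_, fun ⟨_, hq⟩ => ?_⟩
  · have hm := h.localizedHom.map_maximalIdeal_eq_top hnot
    exact ⟨MinimalRingHom.isOneDimValuationRing_quotient_conductorBelow hcoatom hm,
      MinimalRingHom.isQuotientField_conductorQuotientHom hcoatom hm⟩
  · exact MinimalRingHom.isFlatEpimorphism_of_map_denominators_eq_top hf.injective
      (hq.map_denominators_eq_top hf.isCoatom_range hf.injective hnot)
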